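/- \textbf{Setting.} Let $G^+(\mathbb{Q})=\mathrm{GL}^+(2,\mathbb{Q})$ be the group of rational $2\times 2$ matrices of positive determinant, and let $\mathbb{H}$ be the upper half-plane. For a function $f$ on $\mathbb{H}$, an integer $k\ge 0$ and $\gamma=\begin{pmatrix}a&b\\c&d\end{pmatrix}\in G^+(\mathbb{Q})$ put $$(f|_k\gamma)(z)=\det(\gamma)^{k/2}\, f\!\left(\tfrac{az+b}{cz+d}\right)(cz+d)^{-k}.$$ For $k\ge 0$ let $\mathcal{M}_k$ be the complex vector space of functions on $\mathbb{H}$ that are modular forms (holomorphic, also at the cusps) of weight $k$ for the principal congruence subgroup $\Gamma(N)$ for some $N\ge 1$, and let $\mathcal{M}=\bigoplus_{k\ge 0}\mathcal{M}_k$, a graded commutative unital $\mathbb{C}$-algebra. The operators $f\mapsto f|_k\gamma$ on $\mathcal{M}_k$ define a right action $f\mapsto f|\gamma$ of $G^+(\mathbb{Q})$ on $\mathcal{M}$ by algebra automorphisms. The crossed product $\mathcal{A}_{G^+(\mathbb{Q})}=\mathcal{M}\rtimes G^+(\mathbb{Q})$ is the algebra of finite formal sums $\sum_\gamma f_\gamma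 U_\gamma^*$, $f_\gamma\in\mathcal{M}$, with product $$fU_\alpha^*\cdot gU_\beta^*=(f\cdot g|\alpha)\,U_{\beta\alpha}^*.$$ Let $\Delta(z)=(2\pi)^{12}\eta(z)^{24}$, where $\eta$ is the Dedekind eta function. Let $X,Y:\mathcal{M}\to\mathcal{M}$ be the linear operators given on $f\in\mathcal{M}_k$ by $$Y(f)=\frac{k}{2}f\in\mathcal{M}_k,\qquad X(f)=\frac{1}{2\pi i}\frac{df}{dz}-\frac{1}{12\pi i}\,\frac{d}{dz}(\log\Delta)\cdot Y(f)\in\mathcal{M}_{k+2},$$ and for $\gamma\in G^+(\mathbb{Q})$ let $$\mu_\gamma=\frac{1}{12\pi i}\,\frac{d}{dz}\log\frac{\Delta|_{12}\gamma}{\Delta}\in\mathcal{M}_2 .$$ Let $\mathcal{H}_1$ be the Hopf algebra over $\mathbb{C}$ which, as an algebra, is the universal enveloping algebra of the Lie algebra with basis $X$, $Y$, $\delta_n$ $(n\ge 1)$ and brackets $$[Y,X]=X,\quad [Y,\delta_n]=n\,\delta_n,\quad [X,\delta_n]=\delta_{n+1},\quad [\delta_k,\delta_n]=0,$$ with the coproduct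 (an algebra homomorphism, here denoted $\Delta$ as usual) determined by $$\Delta Y=Y\otimes 1+1\otimes Y,\quad \Delta\delta_1=\delta_1\otimes 1+1\otimes\delta_1,\quad \Delta X=X\otimes 1+1\otimes X+\delta_1\otimes Y,$$ the counit $\varepsilon$ vanishing on $X,Y,\delta_n$, and the antipode (an algebra anti-homomorphism) determined by $S(Y)=-Y$, $S(X)=-X+\delta_1Y$, $S(\delta_1)=-\delta_1$. A \emph{Hopf action} of $\mathcal{H}_1$ on a unital $\mathbb{C}$-algebra $A$ is a (unital) $\mathcal{H}_1$-module structure on the vector space $A$ such that $h(ab)=\sum h_{(1)}(a)\,h_{(2)}(b)$ and $h(1)=\varepsilon(h)1$ for all $h\in\mathcal{H}_1$ and $a,b\in A$, where $\Delta h=\sum h_{(1)}\otimes h_{(2)}$. \textbf{Proposition.} There is a unique Hopf action of $\mathcal{H}_1$ on $\mathcal{A}_{G^+(\mathbb{Q})}$ such that, for all $f\in\mathcal{M}$ and $\gamma\in G^+(\mathbb{Q})$, $$X(fU_\gamma^*)=X(f)\,U_\gamma^*,\qquad Y(fU_\gamma^*)=Y(f)\,U_\gamma^*,\qquad \delta_1(fU_\gamma^*)=\mu_\gamma\cdot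 f\,U_\gamma^* .$$ In this action, for all $n\ge 1$, $f\in\mathcal{M}$ and $\gamma\in G^+(\mathbb{Q})$, $$\delta_n(fU_\gamma^*)=X^{n-1}(\mu_\gamma)\cdot f\,U_\gamma^* .$$ -/

import Mathlib

/-! ### The Hopf algebra `H₁` -/

namespace ConnesMoscovici

open scoped TensorProduct

attribute [local instance] LieRing.ofAssociativeRing

noncomputable section

/-- The basis `X, Y, δₙ (n ≥ 1)` of the Lie algebra underlying `H₁`. -/
inductive Gen : Type
  | X : Gen
  | Y : Gen
  | δ : ℕ+ → Gen

/-- The complex vector space with basis `X, Y, δₙ (n ≥ 1)`. -/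
def Lie1 : Type := Gen →₀ ℂ

instance : AddCommGroup Lie1 := inferInstanceAs (AddCommGroup (Gen →₀ ℂ))
instance : Module ℂ Lie1 := inferInstanceAs (Module ℂ (Gen →₀ ℂ))

namespace Lie1

/-- The basis vector of `Lie1` attached to a symbol. -/
def e (a : Gen) : Lie1 := Finsupp.single a (1 : ℂ)

/-- The brackets of the basis vectors: `[Y, X] = X`, `[Y, δₙ] = n δₙ`, `[X, δₙ] = δₙ₊₁`,
`[δₖ, δₗ] = 0`, extended antisymmetrically. -/
def table : Gen → Gen → Lie1
  | .Y, .X => e .X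
  | .X, .Y => -e .X
  | .Y, .δ n => (n : ℂ) • e (.δ n)
  | .δ n, .Y => -((n : ℂ) • e (.δ n))
  | .X, .δ n => e (.δ (n + 1))
  | .δ n, .X => -e (.δ (n + 1))
  | .X, .X => 0
  | .Y, .Y => 0
  | .δ _, .δ _ => 0

/-- The linear map out of `Lie1` with prescribed values on the basis. -/
def extend {V : Type*} [AddCommGroup V] [Module ℂ V] (v : Gen → V) : Lie1 →ₗ[ℂ] V :=
  Finsupp.linearCombination ℂ v

@[simp] lemma extend_e {V : Type*} [AddCommGroup V] [Module ℂ V] (v : Gen → V) (a : Gen) :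
    extend v (e a) = v a :=
  (Finsupp.linearCombination_single ℂ (1 : ℂ) a).trans (one_smul ℂ _)

lemma hom_ext {V : Type*} [AddCommGroup V] [Module ℂ V] {f g : Lie1 →ₗ[ℂ] V}
    (h : ∀ a, f (e a) = g (e a)) : f = g :=
  Finsupp.lhom_ext' fun a => LinearMap.ext_ring (h a)

/-- The bilinear extension of the bracket table. -/
def br : Lie1 →ₗ[ℂ] Lie1 →ₗ[ℂ] Lie1 := extend fun a => extend (table a)

@[simp] lemma br_e (a b : Gen) : br (e a) (e b) = table a b := by simp [br]

lemma br_skew (x y : Lie1) : br x y = -br y x := by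
  have h : br = -br.flip := by
    refine hom_ext fun a => hom_ext fun b => ?_
    cases a <;> cases b <;> simp [table]
  simpa using congr($h x y)

lemma br_self (x : Lie1) : br x x = 0 := by
  have h := br_skew x x
  have h2 : (2 : ℂ) • br x x = 0 := by rw [two_smul]; nth_rewrite 1 [h]; simp
  simpa using h2

lemma br_jacobi (x y z : Lie1) : br x (br y z) = br (br x y) z + br y (br x z) := by
  have h : ∀ a b c, br (e a) (br (e b) (e c)) =
      br (br (e a) (e b)) (e c) + br (e b) (br (e a) (e c)) := by
    intro a b c
    cases a <;> cases b <;> cases c <;> simp [table] <;> module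
  let J (x : Lie1) (y : Lie1) : Lie1 →ₗ[ℂ] Lie1 :=
    (br x).comp (br y) - br (br x y) - (br y).comp (br x)
  suffices hJ : J x y = 0 by
    have := congr($hJ z)
    simp only [J, LinearMap.sub_apply, LinearMap.comp_apply, LinearMap.zero_apply] at this
    rw [sub_sub, sub_eq_zero] at this
    exact this
  have h1 : ∀ a b, J (e a) (e b) = 0 := fun a b => hom_ext fun c => by
    simp only [J, LinearMap.sub_apply, LinearMap.comp_apply, LinearMap.zero_apply]
    rw [h]
    abel
  let J2 : Lie1 →ₗ[ℂ] Lie1 →ₗ[ℂ] (Lie1 →ₗ[ℂ] Lie1) :=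
    LinearMap.mk₂ ℂ J (fun _ _ _ => by ext1 w; simp [J]; abel) (fun c _ _ => by ext1 w; simp [J, smul_sub])
      (fun _ _ _ => by ext1 w; simp [J]; abel) (fun c _ _ => by ext1 w; simp [J, smul_sub])
  have h2 : J2 = 0 := hom_ext fun a => hom_ext fun b => h1 a b
  exact congr($h2 x y)

instance : LieRing Lie1 where
  bracket x y := br x y
  add_lie x y z := by simp
  lie_add x y z := by simp
  lie_self := br_self
  leibniz_lie := br_jacobi

instance : LieAlgebra ℂ Lie1 where
  lie_smul c x y := by simp [Bracket.bracket]

lemma lie_e (a b : Gen) : ⁅e a, e b⁆ = table a b := br_e a b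

end Lie1

/-- As an algebra, `H₁` is the universal enveloping algebra of `Lie1`. -/
abbrev H1 : Type := UniversalEnvelopingAlgebra ℂ Lie1

namespace H1

open Lie1

/-- The generator `X` of `H₁`. -/
def X : H1 := UniversalEnvelopingAlgebra.ι ℂ (e .X)

/-- The generator `Y` of `H₁`. -/
def Y : H1 := UniversalEnvelopingAlgebra.ι ℂ (e .Y)

/-- The generators `δₙ`, `n ≥ 1`, of `H₁`. -/
def δ (n : ℕ+) : H1 := UniversalEnvelopingAlgebra.ι ℂ (e (.δ n))

lemma comm_ι (a b : Gen) :
    UniversalEnvelopingAlgebra.ι ℂ (e a) * UniversalEnvelopingAlgebra.ι ℂ (e b) -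
      UniversalEnvelopingAlgebra.ι ℂ (e b) * UniversalEnvelopingAlgebra.ι ℂ (e a) =
      UniversalEnvelopingAlgebra.ι ℂ (table a b) := by
  rw [← lie_e, LieHom.map_lie, LieRing.of_associative_ring_bracket]

lemma comm_Y_X : Y * X - X * Y = X := comm_ι .Y .X

lemma comm_Y_δ (n : ℕ+) : Y * δ n - δ n * Y = (n : ℂ) • δ n := by
  have := comm_ι .Y (.δ n)
  simp only [table, map_smul] at this
  exact this

lemma comm_X_δ (n : ℕ+) : X * δ n - δ n * X = δ (n + 1) := comm_ι .X (.δ n)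

lemma comm_δ_δ (m n : ℕ+) : δ m * δ n = δ n * δ m := by
  have := comm_ι (.δ m) (.δ n)
  simp only [table, map_zero] at this
  exact sub_eq_zero.mp this

variable {A : Type*} [Ring A] [Algebra ℂ A]

/-- Algebra maps out of `H₁` from elements satisfying the defining relations. -/
def lift (x y : A) (d : ℕ+ → A) (hyx : y * x - x * y = x)
    (hyd : ∀ n, y * d n - d n * y = (n : ℂ) • d n) (hxd : ∀ n, x * d n - d n * x = d (n + 1))
    (hdd : ∀ m n, d m * d n = d n * d m) : H1 →ₐ[ℂ] A :=
  let v : Gen → A := fun a => Gen.rec x y d a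
  UniversalEnvelopingAlgebra.lift ℂ
    { extend v with
      map_lie' := by
        intro p q
        let B₁ : Lie1 →ₗ[ℂ] Lie1 →ₗ[ℂ] A := br.compr₂ (extend v)
        let B₂ : Lie1 →ₗ[ℂ] Lie1 →ₗ[ℂ] A :=
          (LinearMap.mul ℂ A - (LinearMap.mul ℂ A).flip).compl₁₂ (extend v) (extend v)
        have h : B₁ = B₂ := by
          refine hom_ext fun a => hom_ext fun b => ?_
          cases a <;> cases b <;> simp [B₁, B₂, table, v, hyx, hyd, hxd, hdd]
          · rw [← neg_sub, hyx]
          · rw [← neg_sub, hxd]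
          · rw [← neg_sub, hyd]
        exact congr($h p q) }

section lift
variable (x y : A) (d : ℕ+ → A) (hyx : y * x - x * y = x)
    (hyd : ∀ n, y * d n - d n * y = (n : ℂ) • d n) (hxd : ∀ n, x * d n - d n * x = d (n + 1))
    (hdd : ∀ m n, d m * d n = d n * d m)

@[simp] lemma lift_X : lift x y d hyx hyd hxd hdd X = x :=
  (UniversalEnvelopingAlgebra.lift_ι_apply ℂ _ _).trans (extend_e _ _)

@[simp] lemma lift_Y : lift x y d hyx hyd hxd hdd Y = y :=
  (UniversalEnvelopingAlgebra.lift_ι_apply ℂ _ _).trans (extend_e _ _)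

@[simp] lemma lift_δ (n : ℕ+) : lift x y d hyx hyd hxd hdd (δ n) = d n :=
  (UniversalEnvelopingAlgebra.lift_ι_apply ℂ _ _).trans (extend_e _ _)

end lift

/-- `H₁` is generated by `X`, `Y`, `δ₁`. -/
lemma algHom_ext {f g : H1 →ₐ[ℂ] A} (hX : f X = g X) (hY : f Y = g Y) (hd : f (δ 1) = g (δ 1)) :
    f = g := by
  have hδ : ∀ n, f (δ n) = g (δ n) := fun n => by
    induction n using PNat.recOn with
    | one => exact hd
    | succ n ih => rw [← comm_X_δ]; simp [hX, ih]
  apply UniversalEnvelopingAlgebra.hom_ext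
  suffices h : f.toLinearMap ∘ₗ (UniversalEnvelopingAlgebra.ι ℂ : Lie1 →ₗ⁅ℂ⁆ H1).toLinearMap =
      g.toLinearMap ∘ₗ (UniversalEnvelopingAlgebra.ι ℂ : Lie1 →ₗ⁅ℂ⁆ H1).toLinearMap from
    LieHom.ext fun z => congr($h z)
  refine hom_ext fun a => ?_
  cases a with
  | X => exact hX
  | Y => exact hY
  | δ n => exact hδ n

lemma adjoin_eq_top : Algebra.adjoin ℂ {X, Y, δ 1} = ⊤ := by
  set S := Algebra.adjoin ℂ ({X, Y, δ 1} : Set H1) with hS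
  have hX : X ∈ S := Algebra.subset_adjoin (by simp)
  have hY : Y ∈ S := Algebra.subset_adjoin (by simp)
  have h1 : δ 1 ∈ S := Algebra.subset_adjoin (by simp)
  have hδ : ∀ n, δ n ∈ S := fun n => by
    induction n using PNat.recOn with
    | one => exact h1
    | succ n ih =>
      rw [← comm_X_δ]
      exact S.sub_mem (S.mul_mem hX ih) (S.mul_mem ih hX)
  let r : H1 →ₐ[ℂ] S := lift ⟨X, hX⟩ ⟨Y, hY⟩ (fun n => ⟨δ n, hδ n⟩)
    (Subtype.ext comm_Y_X) (fun n => Subtype.ext (comm_Y_δ n)) (fun n => Subtype.ext (comm_X_δ n))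
    (fun m n => Subtype.ext (comm_δ_δ m n))
  have hr : S.val.comp r = AlgHom.id ℂ H1 := by
    apply algHom_ext <;> simp [r]
  refine eq_top_iff.mpr fun h _ => ?_
  have : S.val (r h) = h := congr($hr h)
  rw [← this]
  exact (r h).2

lemma induction {p : H1 → Prop} (h : H1) (hX : p X) (hY : p Y) (hd : p (δ 1))
    (hc : ∀ c : ℂ, p (algebraMap ℂ H1 c)) (hadd : ∀ a b, p a → p b → p (a + b))
    (hmul : ∀ a b, p a → p b → p (a * b)) : p h := by
  have hh : h ∈ Algebra.adjoin ℂ ({X, Y, δ 1} : Set H1) := by rw [adjoin_eq_top]; trivial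
  induction hh using Algebra.adjoin_induction with
  | mem x hx => rcases hx with rfl | rfl | rfl <;> assumption
  | algebraMap c => exact hc c
  | add a b _ _ ha hb => exact hadd a b ha hb
  | mul a b _ _ ha hb => exact hmul a b ha hb

/-- The iterated commutators `[x, [x, … [x, d]]]`, with `n - 1` brackets. -/
def iter {A : Type*} [Ring A] (x d : A) (n : ℕ+) : A := (fun a => x * a - a * x)^[n.natPred] d

@[simp] lemma iter_one {A : Type*} [Ring A] (x d : A) : iter x d 1 = d := rfl

lemma iter_succ {A : Type*} [Ring A] (x d : A) (n : ℕ+) : iter x d (n + 1) = x * iter x d n - iter x d n * x := by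
  have : (n + 1).natPred = n.natPred + 1 := by
    simp [PNat.natPred]
    have := n.pos
    omega
  rw [iter, this, Function.iterate_succ_apply']
  rfl

lemma iter_mem {A : Type*} [Ring A] (x d : A) (C : Set A) (hd : d ∈ C) (hC : ∀ a ∈ C, x * a - a * x ∈ C) (n : ℕ+) :
    iter x d n ∈ C := by
  induction n using PNat.recOn with
  | one => exact hd
  | succ n ih => rw [iter_succ]; exact hC _ ih

/-- Algebra maps out of `H₁` from the images `x, y, d` of `X, Y, δ₁`. The image of `δₙ` is forced
to be an iterated commutator. -/
def lift₁ (x y d : A) (C : Set A) (hyx : y * x - x * y = x) (hyd : y * d - d * y = d)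
    (hd : d ∈ C) (hC : ∀ a ∈ C, x * a - a * x ∈ C) (hCC : ∀ a ∈ C, ∀ b ∈ C, a * b = b * a) :
    H1 →ₐ[ℂ] A :=
  lift x y (iter x d) hyx
    (fun n => by
      induction n using PNat.recOn with
      | one => simpa using hyd
      | succ n ih =>
        rw [iter_succ]
        set a := iter x d n
        have : y * (x * a - a * x) - (x * a - a * x) * y =
            (y * x - x * y) * a - a * (y * x - x * y) + (x * (y * a - a * y) - (y * a - a * y) * x) := by
          noncomm_ring
        rw [this, hyx, ih]
        push_cast
        simp only [mul_smul_comm, smul_mul_assoc]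
        module)
    (fun n => (iter_succ x d n).symm)
    (fun m n => hCC _ (iter_mem x d C hd hC m) _ (iter_mem x d C hd hC n))

section lift₁
variable (x y d : A) (C : Set A) (hyx : y * x - x * y = x) (hyd : y * d - d * y = d)
    (hd : d ∈ C) (hC : ∀ a ∈ C, x * a - a * x ∈ C) (hCC : ∀ a ∈ C, ∀ b ∈ C, a * b = b * a)

@[simp] lemma lift₁_X : lift₁ x y d C hyx hyd hd hC hCC X = x := lift_X ..
@[simp] lemma lift₁_Y : lift₁ x y d C hyx hyd hd hC hCC Y = y := lift_Y ..
@[simp] lemma lift₁_δ_one : lift₁ x y d C hyx hyd hd hC hCC (δ 1) = d := lift_δ ..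

end lift₁

/-- The commutative subalgebra generated by the `δₙ`. -/
def D : Subalgebra ℂ H1 := Algebra.adjoin ℂ (Set.range δ)

lemma δ_mem_D (n : ℕ+) : δ n ∈ D := Algebra.subset_adjoin ⟨n, rfl⟩

lemma D_comm {a b : H1} (ha : a ∈ D) (hb : b ∈ D) : a * b = b * a := by
  refine Algebra.commute_of_mem_adjoin_of_forall_mem_commute hb ?_ |>.eq
  rintro _ ⟨n, rfl⟩
  refine (Algebra.commute_of_mem_adjoin_of_forall_mem_commute ha ?_).symm
  rintro _ ⟨m, rfl⟩
  exact comm_δ_δ n m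

lemma D_stable (t : H1) (ht : ∀ n, t * δ n - δ n * t ∈ D) {a : H1} (ha : a ∈ D) :
    t * a - a * t ∈ D := by
  induction ha using Algebra.adjoin_induction with
  | mem x hx => obtain ⟨n, rfl⟩ := hx; exact ht n
  | algebraMap c => rw [Algebra.commutes, sub_self]; exact D.zero_mem
  | add a b _ _ ha hb =>
    have : t * (a + b) - (a + b) * t = (t * a - a * t) + (t * b - b * t) := by noncomm_ring
    rw [this]; exact D.add_mem ha hb
  | mul a b ha' hb' ha hb =>
    have : t * (a * b) - (a * b) * t = (t * a - a * t) * b + a * (t * b - b * t) := by noncomm_ring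
    rw [this]; exact D.add_mem (D.mul_mem ha hb') (D.mul_mem ha' hb)

lemma D_stable_X {a : H1} (ha : a ∈ D) : X * a - a * X ∈ D :=
  D_stable X (fun n => by rw [comm_X_δ]; exact δ_mem_D _) ha

lemma D_stable_Y {a : H1} (ha : a ∈ D) : Y * a - a * Y ∈ D :=
  D_stable Y (fun n => by rw [comm_Y_δ]; exact D.smul_mem (δ_mem_D _) _) ha

/-- The span of the tensors `a ⊗ b` with `a`, `b` polynomials in the `δₙ`. -/
def DD : Submodule ℂ (H1 ⊗[ℂ] H1) := Submodule.span ℂ {t | ∃ a ∈ D, ∃ b ∈ D, t = a ⊗ₜ[ℂ] b}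

lemma tmul_mem_DD {a b : H1} (ha : a ∈ D) (hb : b ∈ D) : a ⊗ₜ[ℂ] b ∈ DD :=
  Submodule.subset_span ⟨a, ha, b, hb, rfl⟩

lemma DD_comm : ∀ s ∈ DD, ∀ t ∈ DD, s * t = t * s := by
  intro s hs t ht
  induction hs, ht using Submodule.span_induction₂ with
  | mem_mem x y hx hy =>
    obtain ⟨a, ha, b, hb, rfl⟩ := hx
    obtain ⟨c, hc, d, hd, rfl⟩ := hy
    simp [D_comm ha hc, D_comm hb hd]
  | zero_left => simp
  | zero_right => simp
  | add_left x y z _ _ _ h1 h2 => rw [add_mul, mul_add, h1, h2]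
  | add_right x y z _ _ _ h1 h2 => rw [add_mul, mul_add, h1, h2]
  | smul_left r x y _ _ h => rw [smul_mul_assoc, mul_smul_comm, h]
  | smul_right r x y _ _ h => rw [smul_mul_assoc, mul_smul_comm, h]

/-- `Δ X = X ⊗ 1 + 1 ⊗ X + δ₁ ⊗ Y`. -/
def comulX : H1 ⊗[ℂ] H1 := X ⊗ₜ 1 + 1 ⊗ₜ X + δ 1 ⊗ₜ Y

/-- `Δ Y = Y ⊗ 1 + 1 ⊗ Y`. -/
def comulY : H1 ⊗[ℂ] H1 := Y ⊗ₜ 1 + 1 ⊗ₜ Y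

/-- `Δ δ₁ = δ₁ ⊗ 1 + 1 ⊗ δ₁`. -/
def comulδ : H1 ⊗[ℂ] H1 := δ 1 ⊗ₜ 1 + 1 ⊗ₜ δ 1

lemma DD_stable : ∀ s ∈ DD, comulX * s - s * comulX ∈ DD := by
  intro s hs
  induction hs using Submodule.span_induction with
  | mem x hx =>
    obtain ⟨a, ha, b, hb, rfl⟩ := hx
    have : comulX * a ⊗ₜ[ℂ] b - a ⊗ₜ[ℂ] b * comulX =
        (X * a - a * X) ⊗ₜ b + a ⊗ₜ (X * b - b * X) + (δ 1 * a) ⊗ₜ (Y * b - b * Y) := by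
      simp only [comulX, add_mul, mul_add, Algebra.TensorProduct.tmul_mul_tmul, one_mul, mul_one,
        TensorProduct.sub_tmul, TensorProduct.tmul_sub, D_comm ha (δ_mem_D 1)]
      abel
    rw [this]
    exact DD.add_mem (DD.add_mem (tmul_mem_DD (D_stable_X ha) hb) (tmul_mem_DD ha (D_stable_X hb)))
      (tmul_mem_DD (D.mul_mem (δ_mem_D 1) ha) (D_stable_Y hb))
  | zero => simp
  | add x y _ _ hx hy =>
    have : comulX * (x + y) - (x + y) * comulX =
      (comulX * x - x * comulX) + (comulX * y - y * comulX) := by noncomm_ring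
    rw [this]; exact DD.add_mem hx hy
  | smul c x _ hx =>
    rw [mul_smul_comm, smul_mul_assoc, ← smul_sub]; exact DD.smul_mem _ hx

/-- The coproduct of `H₁`: the algebra map with the prescribed values on `X`, `Y`, `δ₁`. -/
def comulHom : H1 →ₐ[ℂ] H1 ⊗[ℂ] H1 :=
  lift₁ comulX comulY comulδ DD
    (by
      have h1 := comm_Y_X
      have h2 : Y * δ 1 - δ 1 * Y = δ 1 := by simpa using comm_Y_δ 1
      have : comulY * comulX - comulX * comulY =
          (Y * X - X * Y) ⊗ₜ 1 + 1 ⊗ₜ (Y * X - X * Y) + (Y * δ 1 - δ 1 * Y) ⊗ₜ Y := by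
        simp only [comulX, comulY, add_mul, mul_add, Algebra.TensorProduct.tmul_mul_tmul, one_mul,
          mul_one, TensorProduct.sub_tmul, TensorProduct.tmul_sub]
        abel
      rw [this, h1, h2, comulX])
    (by
      have h2 : Y * δ 1 - δ 1 * Y = δ 1 := by simpa using comm_Y_δ 1
      have : comulY * comulδ - comulδ * comulY =
          (Y * δ 1 - δ 1 * Y) ⊗ₜ 1 + 1 ⊗ₜ (Y * δ 1 - δ 1 * Y) := by
        simp only [comulδ, comulY, add_mul, mul_add, Algebra.TensorProduct.tmul_mul_tmul, one_mul,
          mul_one, TensorProduct.sub_tmul, TensorProduct.tmul_sub]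
        abel
      rw [this, h2, comulδ])
    (DD.add_mem (tmul_mem_DD (δ_mem_D 1) D.one_mem) (tmul_mem_DD D.one_mem (δ_mem_D 1)))
    DD_stable DD_comm

@[simp] lemma comulHom_X : comulHom X = X ⊗ₜ 1 + 1 ⊗ₜ X + δ 1 ⊗ₜ Y := lift₁_X ..
@[simp] lemma comulHom_Y : comulHom Y = Y ⊗ₜ 1 + 1 ⊗ₜ Y := lift₁_Y ..
@[simp] lemma comulHom_δ_one : comulHom (δ 1) = δ 1 ⊗ₜ 1 + 1 ⊗ₜ δ 1 := lift₁_δ_one ..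

/-- The counit of `H₁`: the constant term. -/
def counitHom : H1 →ₐ[ℂ] ℂ :=
  lift 0 0 (fun _ => 0) (by simp) (by simp) (by simp) (by simp)

@[simp] lemma counitHom_X : counitHom X = 0 := lift_X ..
@[simp] lemma counitHom_Y : counitHom Y = 0 := lift_Y ..
@[simp] lemma counitHom_δ (n : ℕ+) : counitHom (δ n) = 0 := lift_δ ..

instance : Bialgebra ℂ H1 :=
  Bialgebra.ofAlgHom comulHom counitHom
    (by
      apply algHom_ext <;>
        simp [TensorProduct.add_tmul, TensorProduct.tmul_add, Algebra.TensorProduct.one_def] <;>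
        abel)
    (by apply algHom_ext <;> simp)
    (by apply algHom_ext <;> simp)

/-- The antipode of `H₁` as an algebra map to the opposite algebra:
`S(X) = -X + δ₁ Y`, `S(Y) = -Y`, `S(δ₁) = -δ₁`. -/
def antipodeHom : H1 →ₐ[ℂ] H1ᵐᵒᵖ :=
  lift₁ (.op (-X + δ 1 * Y)) (.op (-Y)) (.op (-δ 1)) {a | a.unop ∈ D}
    (by
      have h1 := comm_Y_X
      have h2 : Y * δ 1 - δ 1 * Y = δ 1 := by simpa using comm_Y_δ 1
      apply MulOpposite.unop_injective
      simp only [MulOpposite.unop_sub, MulOpposite.unop_mul, MulOpposite.unop_op]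
      have : (-X + δ 1 * Y) * -Y - -Y * (-X + δ 1 * Y) =
        -(Y * X - X * Y) + (Y * δ 1 - δ 1 * Y) * Y := by noncomm_ring
      rw [this, h1, h2])
    (by
      have h2 : Y * δ 1 - δ 1 * Y = δ 1 := by simpa using comm_Y_δ 1
      apply MulOpposite.unop_injective
      simp only [MulOpposite.unop_sub, MulOpposite.unop_mul, MulOpposite.unop_op]
      have : -δ 1 * -Y - -Y * -δ 1 = -(Y * δ 1 - δ 1 * Y) := by noncomm_ring
      rw [this, h2])
    (D.neg_mem (δ_mem_D 1))
    (by
      intro a ha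
      have ha : a.unop ∈ D := ha
      simp only [Set.mem_ofPred_eq, MulOpposite.unop_sub, MulOpposite.unop_mul,
        MulOpposite.unop_op]
      generalize a.unop = b at ha
      have : b * (-X + δ 1 * Y) - (-X + δ 1 * Y) * b =
          (X * b - b * X) + ((b * δ 1 - δ 1 * b) * Y - δ 1 * (Y * b - b * Y)) := by noncomm_ring
      rw [this, D_comm ha (δ_mem_D 1), sub_self, zero_mul, zero_sub]
      exact D.add_mem (D_stable_X ha) (D.neg_mem (D.mul_mem (δ_mem_D 1) (D_stable_Y ha))))
    (fun a ha b hb => MulOpposite.unop_injective (D_comm hb ha))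

@[simp] lemma antipodeHom_X : antipodeHom X = .op (-X + δ 1 * Y) := lift₁_X ..
@[simp] lemma antipodeHom_Y : antipodeHom Y = .op (-Y) := lift₁_Y ..
@[simp] lemma antipodeHom_δ_one : antipodeHom (δ 1) = .op (-δ 1) := lift₁_δ_one ..

/-- The antipode of `H₁`. -/
def antipodeLin : H1 →ₗ[ℂ] H1 :=
  (MulOpposite.opLinearEquiv ℂ).symm.toLinearMap ∘ₗ antipodeHom.toLinearMap

@[simp] lemma antipodeLin_X : antipodeLin X = -X + δ 1 * Y :=
  congr_arg MulOpposite.unop antipodeHom_X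
@[simp] lemma antipodeLin_Y : antipodeLin Y = -Y := congr_arg MulOpposite.unop antipodeHom_Y
@[simp] lemma antipodeLin_δ_one : antipodeLin (δ 1) = -δ 1 :=
  congr_arg MulOpposite.unop antipodeHom_δ_one
@[simp] lemma antipodeLin_algebraMap (c : ℂ) :
    antipodeLin (algebraMap ℂ H1 c) = algebraMap ℂ H1 c := by
  simp [antipodeLin]
@[simp] lemma antipodeLin_one : antipodeLin 1 = 1 := by simp [antipodeLin]
lemma antipodeLin_mul (a b : H1) : antipodeLin (a * b) = antipodeLin b * antipodeLin a := by
  simp [antipodeLin]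

/-- `a ⊗ b ↦ S(a) b`. -/
def antiL : H1 ⊗[ℂ] H1 →ₗ[ℂ] H1 := LinearMap.mul' ℂ H1 ∘ₗ antipodeLin.rTensor H1

/-- `a ⊗ b ↦ a S(b)`. -/
def antiR : H1 ⊗[ℂ] H1 →ₗ[ℂ] H1 := LinearMap.mul' ℂ H1 ∘ₗ antipodeLin.lTensor H1

@[simp] lemma antiL_tmul (a b : H1) : antiL (a ⊗ₜ b) = antipodeLin a * b := by simp [antiL]
@[simp] lemma antiR_tmul (a b : H1) : antiR (a ⊗ₜ b) = a * antipodeLin b := by simp [antiR]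

lemma antiL_mul (u v : H1 ⊗[ℂ] H1) (c : ℂ) (hu : antiL u = algebraMap ℂ H1 c) :
    antiL (u * v) = c • antiL v := by
  induction v with
  | zero => simp
  | add v w hv hw => rw [mul_add, map_add, map_add, hv, hw, smul_add]
  | tmul a b =>
    have : ∀ w : H1 ⊗[ℂ] H1, antiL (w * a ⊗ₜ b) = antipodeLin a * antiL w * b := by
      intro w
      induction w with
      | zero => simp
      | add v w hv hw => rw [add_mul, map_add, map_add, hv, hw]; noncomm_ring
      | tmul p q => simp [antipodeLin_mul, mul_assoc]
    rw [this, hu, antiL_tmul, ← Algebra.commutes, mul_assoc, Algebra.smul_def]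

lemma antiR_mul (u v : H1 ⊗[ℂ] H1) (c : ℂ) (hv : antiR v = algebraMap ℂ H1 c) :
    antiR (u * v) = c • antiR u := by
  induction u with
  | zero => simp
  | add v w hv hw => rw [add_mul, map_add, map_add, hv, hw, smul_add]
  | tmul a b =>
    have : ∀ w : H1 ⊗[ℂ] H1, antiR (a ⊗ₜ b * w) = a * antiR w * antipodeLin b := by
      intro w
      induction w with
      | zero => simp
      | add v w hv hw => rw [mul_add, map_add, map_add, hv, hw]; noncomm_ring
      | tmul p q => simp [antipodeLin_mul, mul_assoc]
    rw [this, hv, antiR_tmul, ← Algebra.commutes, mul_assoc, Algebra.smul_def]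

lemma antiL_comul (h : H1) : antiL (comulHom h) = algebraMap ℂ H1 (counitHom h) := by
  induction h using H1.induction with
  | hX => simp
  | hY => simp
  | hd => simp
  | hc c => simp [Algebra.algebraMap_eq_smul_one, Algebra.TensorProduct.one_def]
  | hadd a b ha hb => simp [ha, hb]
  | hmul a b ha hb =>
    rw [map_mul, antiL_mul _ _ _ ha, hb, map_mul, map_mul, Algebra.smul_def]

lemma antiR_comul (h : H1) : antiR (comulHom h) = algebraMap ℂ H1 (counitHom h) := by
  induction h using H1.induction with
  | hX => simp
  | hY => simp
  | hd => simp
  | hc c => simp [Algebra.algebraMap_eq_smul_one, Algebra.TensorProduct.one_def]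
  | hadd a b ha hb => simp [ha, hb]
  | hmul a b ha hb =>
    rw [map_mul, antiR_mul _ _ _ hb, ha, map_mul, map_mul, Algebra.smul_def, Algebra.commutes]

/-- The Hopf algebra `H₁`. -/
instance : HopfAlgebra ℂ H1 where
  antipode := antipodeLin
  mul_antipode_rTensor_comul := LinearMap.ext antiL_comul
  mul_antipode_lTensor_comul := LinearMap.ext antiR_comul

end H1

end

end ConnesMoscovici

/-! ### Modular forms of all levels and the crossed product with `GL⁺(2, ℚ)` -/

namespace ConnesMoscovici

open UpperHalfPlane hiding I
open Complex
open scoped MatrixGroups ModularForm Manifold DirectSum Pointwise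

noncomputable section

/-- The group `GL⁺(2, ℚ)`. -/
abbrev GQ : Type := Matrix.GLPos (Fin 2) ℚ

/-- The inclusion of `GL⁺(2, ℚ)` in `GL(2, ℝ)`. -/
def toGLR : GQ →* GL (Fin 2) ℝ :=
  (Matrix.GeneralLinearGroup.map (Rat.castHom ℝ)).comp (Matrix.GLPos (Fin 2) ℚ).subtype

/-- The slash operation `(f |ₖ γ)(z) = det(γ)^{k/2} f(γ z) (c z + d)^{-k}`. -/
def slash (k : ℕ) (f : ℍ → ℂ) (γ : GQ) : ℍ → ℂ := fun z =>
  (((toGLR γ).det.val ^ ((k : ℝ) / 2) : ℝ) : ℂ) * f (toGLR γ • z) *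
    denom (toGLR γ) z ^ (-(k : ℤ))

lemma det_pos (γ : GQ) : 0 < (toGLR γ).det.val := by
  have h : 0 < γ.1.det.val := γ.2
  have : (toGLR γ).det.val = ((γ.1.det.val : ℚ) : ℝ) := by
    simp [toGLR, Matrix.GeneralLinearGroup.map_det]
  rw [this]
  exact_mod_cast h

lemma σ_toGLR (γ : GQ) (x : ℂ) : σ (toGLR γ) x = x := by
  rw [σ, if_pos (det_pos γ)]
  rfl

/-- The ratio between the two normalizations of the slash operation. -/
def ratio (k : ℕ) (γ : GQ) : ℂ :=
  (((toGLR γ).det.val ^ (1 - (k : ℝ) / 2) : ℝ) : ℂ)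

lemma slash_eq (k : ℕ) (f : ℍ → ℂ) (γ : GQ) :
    slash k f γ = ratio k γ • (f ∣[(k : ℤ)] toGLR γ) := by
  ext z
  have h := det_pos γ
  simp only [slash, ratio, Pi.smul_apply, smul_eq_mul, ModularForm.slash_apply, σ_toGLR,
    abs_of_pos h]
  have : (((toGLR γ).det.val ^ ((k : ℝ) / 2) : ℝ) : ℂ) =
      (((toGLR γ).det.val ^ (1 - (k : ℝ) / 2) : ℝ) : ℂ) * (((toGLR γ).det.val : ℝ) : ℂ) ^ ((k : ℤ) - 1) := by
    rw [← Complex.ofReal_zpow, ← Complex.ofReal_mul, ← Real.rpow_intCast, ← Real.rpow_add h]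
    congr 2
    push_cast
    ring
  rw [this]
  ring

lemma ratio_mul (k : ℕ) (γ γ' : GQ) : ratio k (γ * γ') = ratio k γ * ratio k γ' := by
  simp only [ratio, map_mul, Units.val_mul]
  rw [Real.mul_rpow (det_pos γ).le (det_pos γ').le, Complex.ofReal_mul]

lemma slash_mul (k : ℕ) (f : ℍ → ℂ) (γ γ' : GQ) :
    slash k f (γ * γ') = slash k (slash k f γ) γ' := by
  simp only [slash_eq, ratio_mul, map_mul, SlashAction.slash_mul, ModularForm.smul_slash, σ_toGLR,
    smul_smul]
  rw [mul_comm]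

lemma slash_one (k : ℕ) (f : ℍ → ℂ) : slash k f 1 = f := by
  simp [slash_eq, ratio]

lemma slash_add (k : ℕ) (f g : ℍ → ℂ) (γ : GQ) :
    slash k (f + g) γ = slash k f γ + slash k g γ := by
  ext z; simp only [slash, Pi.add_apply]; ring

lemma slash_smul (k : ℕ) (c : ℂ) (f : ℍ → ℂ) (γ : GQ) :
    slash k (c • f) γ = c • slash k f γ := by
  ext z; simp only [slash, Pi.smul_apply, smul_eq_mul]; ring

lemma mul_slash (k l : ℕ) (f g : ℍ → ℂ) (γ : GQ) :
    slash (k + l) (f * g) γ = slash k f γ * slash l g γ := by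
  ext z
  simp only [slash, Pi.mul_apply]
  have h1 : (toGLR γ).det.val ^ (((k + l : ℕ) : ℝ) / 2) =
      (toGLR γ).det.val ^ ((k : ℝ) / 2) * (toGLR γ).det.val ^ ((l : ℝ) / 2) := by
    rw [← Real.rpow_add (det_pos γ)]; congr 1; push_cast; ring
  have h2 : denom (toGLR γ) z ^ (-((k + l : ℕ) : ℤ)) =
      denom (toGLR γ) z ^ (-(k : ℤ)) * denom (toGLR γ) z ^ (-(l : ℤ)) := by
    rw [← zpow_add₀ (denom_ne_zero _ z)]; congr 1; push_cast; ring
  rw [h1, h2]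
  push_cast
  ring

lemma one_slash (γ : GQ) : slash 0 1 γ = 1 := by
  ext z; simp [slash]

/-- The principal congruence subgroup `Γ(N)` inside `GL(2, ℝ)`. -/
abbrev ΓR (N : ℕ) : Subgroup (GL (Fin 2) ℝ) :=
  (CongruenceSubgroup.Gamma N).map (Matrix.SpecialLinearGroup.mapGL ℝ)

/-- Restriction of a modular form to a smaller group. -/
def restrict {Γ Γ' : Subgroup (GL (Fin 2) ℝ)} {k : ℤ} (h : Γ' ≤ Γ) (f : ModularForm Γ k) :
    ModularForm Γ' k where
  toFun := f
  slash_action_eq' γ hγ := f.slash_action_eq' γ (h hγ)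
  holo' := f.holo'
  bdd_at_cusps' hc := f.bdd_at_cusps' (hc.mono h)

lemma ΓR_le {M N : ℕ} (h : M ∣ N) : ΓR N ≤ ΓR M := by
  apply Subgroup.map_mono
  intro γ hγ
  rw [CongruenceSubgroup.Gamma_mem] at hγ ⊢
  have key : ∀ a b : ℤ, (a : ZMod N) = b → (a : ZMod M) = b := by
    intro a b hab
    rw [ZMod.intCast_eq_intCast_iff_dvd_sub] at hab ⊢
    exact (Int.natCast_dvd_natCast.mpr h).trans hab
  have h0 := hγ
  refine ⟨?_, ?_, ?_, ?_⟩
  · simpa using key _ 1 (by simpa using hγ.1)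
  · simpa using key _ 0 (by simpa using hγ.2.1)
  · simpa using key _ 0 (by simpa using hγ.2.2.1)
  · simpa using key _ 1 (by simpa using hγ.2.2.2)

/-- `M k` is the space `ℳₖ` of modular forms of weight `k` of all levels: the functions on the
upper half-plane that are modular forms of weight `k` for some `Γ(N)`, `N ≥ 1`. -/
def M (k : ℕ) : Submodule ℂ (ℍ → ℂ) where
  carrier := {f | ∃ N : ℕ, N ≠ 0 ∧ ∃ g : ModularForm (ΓR N) k, ⇑g = f}
  zero_mem' := ⟨1, one_ne_zero, 0, rfl⟩
  add_mem' := by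
    rintro _ _ ⟨N, hN, f, rfl⟩ ⟨N', hN', g, rfl⟩
    exact ⟨N * N', mul_ne_zero hN hN', restrict (ΓR_le (dvd_mul_right _ _)) f +
      restrict (ΓR_le (dvd_mul_left _ _)) g, rfl⟩
  smul_mem' := by
    rintro c _ ⟨N, hN, f, rfl⟩
    exact ⟨N, hN, c • f, rfl⟩

instance : SetLike.GradedMonoid M where
  one_mem := ⟨1, one_ne_zero, (1 : ModularForm (ΓR 1) 0), rfl⟩
  mul_mem := by
    rintro k l _ _ ⟨N, hN, f, rfl⟩ ⟨N', hN', g, rfl⟩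
    exact ⟨N * N', mul_ne_zero hN hN', ModularForm.mcast (by push_cast; rfl)
      (ModularForm.mul (restrict (ΓR_le (dvd_mul_right N N')) f)
        (restrict (ΓR_le (dvd_mul_left N' N)) g)), rfl⟩

/-- The slash operation of `GL⁺(2, ℚ)` preserves modular forms of all levels. -/
lemma slash_mem {k : ℕ} {f : ℍ → ℂ} (hf : f ∈ M k) (γ : GQ) : slash k f γ ∈ M k := by
  rw [slash_eq]
  refine (M k).smul_mem _ ?_
  obtain ⟨N, hN, f, rfl⟩ := hf
  have : NeZero N := ⟨hN⟩
  obtain ⟨N', hN', h⟩ := CongruenceSubgroup.exists_Gamma_le_conj' γ.1 N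
  refine ⟨N', hN', restrict ?_ (ModularForm.translate f (toGLR γ)), rfl⟩
  rw [Subgroup.pointwise_smul_subset_iff] at h
  simpa using! h

/-- The slash operation on `ℳₖ`. -/
def slashL (k : ℕ) (γ : GQ) : M k →ₗ[ℂ] M k where
  toFun f := ⟨slash k f γ, slash_mem f.2 γ⟩
  map_add' f g := Subtype.ext (slash_add k f g γ)
  map_smul' c f := Subtype.ext (slash_smul k c f γ)

/-- The algebra `ℳ = ⨁ₖ ℳₖ` of modular forms of all levels. -/
def Mod : Type := ⨁ k, M k

instance : CommRing Mod := inferInstanceAs (CommRing (⨁ k, M k))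
instance : Algebra ℂ Mod := inferInstanceAs (Algebra ℂ (⨁ k, M k))

/-- The inclusion of the homogeneous component `ℳₖ` in `ℳ`. -/
def ofM (k : ℕ) : M k →ₗ[ℂ] Mod := DirectSum.lof ℂ ℕ (fun k => M k) k

/-- The linear map out of `ℳ` with prescribed restrictions to the homogeneous components. -/
def ModLift {V : Type*} [AddCommMonoid V] [Module ℂ V] (φ : ∀ k, M k →ₗ[ℂ] V) : Mod →ₗ[ℂ] V :=
  DirectSum.toModule ℂ ℕ V φ

@[simp] lemma ModLift_ofM {V : Type*} [AddCommMonoid V] [Module ℂ V] (φ : ∀ k, M k →ₗ[ℂ] V)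
    (k : ℕ) (f : M k) : ModLift φ (ofM k f) = φ k f :=
  DirectSum.toModule_lof (φ := φ) ℂ k f

lemma Mod_ext {V : Type*} [AddCommMonoid V] [Module ℂ V] {φ ψ : Mod →ₗ[ℂ] V}
    (h : ∀ k f, φ (ofM k f) = ψ (ofM k f)) : φ = ψ :=
  DirectSum.linearMap_ext ℂ fun k => LinearMap.ext (h k)

lemma ofM_mul {k l : ℕ} (f : M k) (g : M l) :
    ofM k f * ofM l g = ofM (k + l) ⟨f * g, SetLike.mul_mem_graded f.2 g.2⟩ :=
  DirectSum.of_mul_of (A := fun k => M k) f g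

lemma one_eq_ofM : (1 : Mod) = ofM 0 ⟨1, SetLike.one_mem_graded M⟩ := rfl

/-- The slash operation on `ℳ`, relative to the weight on each homogeneous component. -/
def slashMod (γ : GQ) : Mod →ₗ[ℂ] Mod := ModLift fun k => ofM k ∘ₗ slashL k γ

@[simp] lemma slashMod_ofM (γ : GQ) (k : ℕ) (f : M k) :
    slashMod γ (ofM k f) = ofM k (slashL k γ f) :=
  ModLift_ofM _ k f

lemma slashMod_one (γ : GQ) : slashMod γ 1 = 1 := by
  rw [one_eq_ofM, slashMod_ofM]
  exact congr_arg (ofM 0) (Subtype.ext (one_slash γ))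

lemma slashMod_mul (γ : GQ) (f g : Mod) : slashMod γ (f * g) = slashMod γ f * slashMod γ g := by
  have h : (LinearMap.mul ℂ Mod).compr₂ (slashMod γ) =
      (LinearMap.mul ℂ Mod).compl₁₂ (slashMod γ) (slashMod γ) := by
    refine Mod_ext fun k f => Mod_ext fun l g => ?_
    simp only [LinearMap.compr₂_apply, LinearMap.compl₁₂_apply, LinearMap.mul_apply', ofM_mul,
      slashMod_ofM]
    exact congr_arg (ofM (k + l)) (Subtype.ext (mul_slash k l f g γ))
  exact congr($h f g)

/-- The right action of `GL⁺(2, ℚ)` on `ℳ` by the slash operation, as a left action of the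
opposite group. -/
instance : MulSemiringAction GQᵐᵒᵖ Mod where
  smul γ f := slashMod γ.unop f
  one_smul f := by
    have h : slashMod 1 = LinearMap.id := Mod_ext fun k f => by
      rw [slashMod_ofM]
      exact congr_arg (ofM k) (Subtype.ext (slash_one k f))
    exact congr($h f)
  mul_smul a b f := by
    have h : slashMod (b.unop * a.unop) = slashMod a.unop ∘ₗ slashMod b.unop :=
      Mod_ext fun k f => by
        rw [LinearMap.comp_apply, slashMod_ofM, slashMod_ofM, slashMod_ofM]
        exact congr_arg (ofM k) (Subtype.ext (slash_mul k f _ _))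
    exact congr($h f)
  smul_zero _ := map_zero _
  smul_add _ := map_add _
  smul_one _ := slashMod_one _
  smul_mul _ := slashMod_mul _

instance : SMulCommClass GQᵐᵒᵖ ℂ Mod where
  smul_comm γ c f := map_smul (slashMod γ.unop) c f

/-- The crossed product algebra `𝒜 = ℳ ⋊ GL⁺(2, ℚ)`. -/
abbrev CrossedProduct : Type := SkewMonoidAlgebra Mod GQᵐᵒᵖ

/-- The element `f U*_γ` of the crossed product. -/
def fU (f : Mod) (γ : GQ) : CrossedProduct := SkewMonoidAlgebra.single (MulOpposite.op γ) f

/-- The multiplication rule `f U*_α · g U*_β = (f · g|α) U*_{βα}`. -/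
lemma fU_mul_fU (f g : Mod) (α β : GQ) : fU f α * fU g β = fU (f * slashMod α g) (β * α) :=
  SkewMonoidAlgebra.single_mul_single

/-! ### The operators `X`, `Y` on modular forms and the cocycle `μ` -/

/-- The discriminant `Δ = (2π)¹² η²⁴`. -/
def Disc (z : ℍ) : ℂ := (2 * (Real.pi : ℂ)) ^ 12 * ModularForm.eta z ^ 24

/-- The operator `X f = (1/2πi) f' - (1/12πi) (Δ'/Δ) (k/2) f` on functions, in weight `k`. -/
def XFun (k : ℕ) (f : ℍ → ℂ) (z : ℍ) : ℂ :=
  1 / (2 * Real.pi * I) * deriv (f ∘ ofComplex) z -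
    1 / (12 * Real.pi * I) * logDeriv (Disc ∘ ofComplex) z * ((k : ℂ) / 2 * f z)

/-- `μ_γ = (1/12πi) (d/dz) log ((Δ|γ)/Δ)`. -/
def muFun (γ : GQ) (z : ℍ) : ℂ :=
  1 / (12 * Real.pi * I) * logDeriv ((fun w => slash 12 Disc γ w / Disc w) ∘ ofComplex) z

lemma Disc_ne_zero (z : ℍ) : Disc z ≠ 0 := by
  have h : (Real.pi : ℂ) ≠ 0 := by exact_mod_cast Real.pi_ne_zero
  exact mul_ne_zero (pow_ne_zero _ (mul_ne_zero two_ne_zero h)) (pow_ne_zero _ (ModularForm.eta_ne_zero z.2))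

lemma Disc_eq : Disc = (2 * (Real.pi : ℂ)) ^ 12 • ModularForm.discriminant := rfl

lemma Disc_mdiff : MDiff Disc := by
  rw [Disc_eq]
  exact (CuspForm.discriminant.holo').const_smul _

lemma Disc_SL (γ : SL(2, ℤ)) : Disc ∣[(12 : ℤ)] γ = Disc := by
  rw [Disc_eq, ModularForm.SL_smul_slash]
  congr 1
  exact CuspForm.discriminant.slash_action_eq' (Matrix.SpecialLinearGroup.mapGL ℝ γ) ⟨γ, rfl⟩

lemma logDeriv_Disc (z : ℍ) :
    logDeriv (Disc ∘ ofComplex) z = 2 * Real.pi * I * EisensteinSeries.E2 z := by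
  have hpi : (Real.pi : ℂ) ≠ 0 := by exact_mod_cast Real.pi_ne_zero
  have hev : (Disc ∘ ofComplex) =ᶠ[nhds (z : ℂ)]
      fun w => (2 * (Real.pi : ℂ)) ^ 12 * (ModularForm.eta w ^ 24) := by
    filter_upwards [isOpen_upperHalfPlaneSet.mem_nhds z.im_pos] with w hw
    simp [Disc, ofComplex_apply_of_im_pos hw]
  have hd := ModularForm.differentiableAt_eta_of_mem_upperHalfPlaneSet z.2
  rw [logDeriv_apply, hev.deriv_eq, hev.eq_of_nhds, ← logDeriv_apply,
    logDeriv_const_mul _ _ (pow_ne_zero _ (mul_ne_zero two_ne_zero hpi))]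
  have := logDeriv_fun_pow hd 24
  rw [this, ModularForm.logDeriv_eta_eq_E2]
  push_cast
  ring

lemma XFun_eq (k : ℕ) (f : ℍ → ℂ) : XFun k f = Derivative.serreDerivative k f := by
  have hpi : (Real.pi : ℂ) ≠ 0 := by exact_mod_cast Real.pi_ne_zero
  ext z
  rw [XFun, logDeriv_Disc, Derivative.serreDerivative_apply, Derivative.normalizedDerivOfComplex]
  have := I_ne_zero
  field_simp

/-- The derivative of a holomorphic function bounded at `i∞` is bounded at `i∞`. -/
lemma bounded_deriv {f : ℍ → ℂ} (hf : MDiff f) (hb : IsBoundedAtImInfty f) :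
    IsBoundedAtImInfty (Derivative.normalizedDerivOfComplex f) := by
  rw [isBoundedAtImInfty_iff] at hb ⊢
  obtain ⟨B, A, h⟩ := hb
  refine ⟨‖(2 * Real.pi * I : ℂ)⁻¹‖ * (B / 1), max A 0 + 2, fun z hz => ?_⟩
  rw [Derivative.normalizedDerivOfComplex, norm_mul]
  refine mul_le_mul_of_nonneg_left ?_ (norm_nonneg _)
  have him : ∀ w ∈ Metric.closedBall (z : ℂ) 1, max A 0 + 1 ≤ w.im := by
    intro w hw
    have h1 : |(w - z).im| ≤ 1 := (Complex.abs_im_le_norm _).trans (by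
      simpa [dist_eq_norm] using hw)
    have h2 := (abs_le.mp h1).1
    simp only [Complex.sub_im, coe_im] at h2
    linarith
  have hdiff := UpperHalfPlane.mdifferentiable_iff.mp hf
  apply Complex.norm_deriv_le_of_forall_mem_sphere_norm_le one_pos
  · apply DifferentiableOn.diffContOnCl
    rw [closure_ball _ one_ne_zero]
    refine hdiff.mono fun w hw => ?_
    have := him w hw
    have h0 : (0 : ℝ) ≤ max A 0 := le_max_right _ _
    change 0 < w.im
    linarith
  · intro w hw
    have h1 := him w (Metric.sphere_subset_closedBall hw)
    have h0 : (0 : ℝ) ≤ max A 0 := le_max_right _ _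
    have hA : A ≤ max A 0 := le_max_left _ _
    have hw : 0 < w.im := by linarith
    rw [Function.comp_apply, ofComplex_apply_of_im_pos hw]
    exact h _ (by change A ≤ w.im; linarith)

lemma bounded_serre {f : ℍ → ℂ} (k : ℂ) (hf : MDiff f) (hb : IsBoundedAtImInfty f) :
    IsBoundedAtImInfty (Derivative.serreDerivative k f) := by
  have h1 := bounded_deriv hf hb
  have h2 : IsBoundedAtImInfty ((k * 12⁻¹) • (EisensteinSeries.E2 * f)) :=
    (EisensteinSeries.isBoundedAtImInfty_E2.mul hb).const_smul_left _
  have : Derivative.serreDerivative k f =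
      Derivative.normalizedDerivOfComplex f - (k * 12⁻¹) • (EisensteinSeries.E2 * f) := by
    ext z; simp; ring
  rw [this]
  exact h1.sub h2

/-- Holomorphic functions that are slash-invariant under `Γ(N)` and such that all translates by
`SL(2, ℤ)` are bounded at `i∞` are modular forms. -/
lemma mem_M_of {k : ℕ} {f : ℍ → ℂ} (N : ℕ) (hN : N ≠ 0) (hf : MDiff f)
    (hinv : ∀ γ ∈ CongruenceSubgroup.Gamma N, f ∣[(k : ℤ)] γ = f)
    (hb : ∀ γ : SL(2, ℤ), IsBoundedAtImInfty (f ∣[(k : ℤ)] γ)) : f ∈ M k := by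
  have : NeZero N := ⟨hN⟩
  refine ⟨N, hN, { toFun := f, slash_action_eq' := ?_, holo' := hf, bdd_at_cusps' := ?_ }, rfl⟩
  · rintro _ ⟨γ, hγ, rfl⟩
    exact hinv γ hγ
  · intro c hc
    rw [Subgroup.IsArithmetic.isCusp_iff_isCusp_SL2Z] at hc
    exact (OnePoint.isBoundedAt_iff_forall_SL2Z hc).mpr fun γ _ => hb γ

lemma M_mdiff {k : ℕ} {f : ℍ → ℂ} (hf : f ∈ M k) : MDiff f := by
  obtain ⟨N, hN, f, rfl⟩ := hf
  exact f.holo'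

/-- `X` raises the weight by `2`. -/
lemma XFun_mem {k : ℕ} {f : ℍ → ℂ} (hf : f ∈ M k) : XFun k f ∈ M (k + 2) := by
  obtain ⟨N, hN, f, rfl⟩ := hf
  have : NeZero N := ⟨hN⟩
  have hcast : (((k + 2 : ℕ) : ℤ)) = (k : ℤ) + 2 := by push_cast; rfl
  rw [XFun_eq]
  refine mem_M_of N hN (Derivative.serreDerivative_mdifferentiable _ f.holo') ?_ ?_
  · intro γ hγ
    rw [hcast]
    exact Derivative.serreDerivative_slash_invariant (k := (k : ℤ)) f.holo'
      (f.slash_action_eq' _ ⟨γ, hγ, rfl⟩)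
  · intro γ
    rw [hcast]
    have := Derivative.serreDerivative_slash_equivariant (k := (k : ℤ)) f.holo' (γ := γ)
    refine this ▸ bounded_serre _ (f.holo'.slash _ _) ?_
    exact ModularFormClass.bdd_at_infty_slash f γ

/-- The logarithmic derivative `(1/2πi) F'/F`. -/
def L (F : ℍ → ℂ) (z : ℍ) : ℂ := Derivative.normalizedDerivOfComplex F z / F z

lemma L_slash {F : ℍ → ℂ} (hF : MDiff F) (h0 : ∀ z, F z ≠ 0) {g : GL (Fin 2) ℝ}
    (hg : 0 < g.det.val) (z : ℍ) :
    L (F ∣[(12 : ℤ)] g) z =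
      (L F ∣[(2 : ℤ)] g) z - 12 * (2 * Real.pi * I)⁻¹ * (g 1 0 / denom g z) := by
  have hσ (x) : σ g x = x := by rw [σ, if_pos hg]; rfl
  have h := congrFun (Derivative.normalizedDerivOfComplex_slash (k := 12) hF (g := g) hg) z
  have hd : (g.det.val : ℂ) ≠ 0 := by exact_mod_cast hg.ne'
  have hz := denom_ne_zero g z
  have hne : (F ∣[(12 : ℤ)] g) z ≠ 0 := by
    rw [ModularForm.slash_apply, hσ]
    exact mul_ne_zero (mul_ne_zero (h0 _) (zpow_ne_zero _ (by simpa using hd)))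
      (zpow_ne_zero _ hz)
  have h2 : (Derivative.normalizedDerivOfComplex F ∣[(12 : ℤ) + 2] g) z =
      (g.det.val : ℂ) * ((F ∣[(12 : ℤ)] g) z * (L F ∣[(2 : ℤ)] g) z) := by
    have : Derivative.normalizedDerivOfComplex F = F * L F := by
      ext w; simp [L, mul_div_cancel₀ _ (h0 w)]
    rw [this, ModularForm.mul_slash, abs_of_pos hg]
    simp
  rw [L, h, h2]
  have : (g.val.det : ℂ) = (g.det.val : ℂ) := rfl
  rw [this]
  field_simp
  push_cast
  ring

/-- The difference of the logarithmic derivatives of `Δ|g` and `Δ`. -/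
def κ (g : GL (Fin 2) ℝ) (z : ℍ) : ℂ := L (Disc ∣[(12 : ℤ)] g) z - L Disc z

lemma Disc_slash_ne_zero {g : GL (Fin 2) ℝ} (hg : 0 < g.det.val) (z : ℍ) :
    (Disc ∣[(12 : ℤ)] g) z ≠ 0 := by
  have hd : (g.det.val : ℂ) ≠ 0 := by exact_mod_cast hg.ne'
  have hσ (x) : σ g x = x := by rw [σ, if_pos hg]; rfl
  rw [ModularForm.slash_apply, hσ]
  exact mul_ne_zero (mul_ne_zero (Disc_ne_zero _) (zpow_ne_zero _ (by simpa using hd)))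
      (zpow_ne_zero _ (denom_ne_zero g z))

lemma sub_slash (k : ℤ) (f g : ℍ → ℂ) (A : GL (Fin 2) ℝ) :
    (f - g) ∣[k] A = f ∣[k] A - g ∣[k] A := by
  rw [sub_eq_add_neg, SlashAction.add_slash, SlashAction.neg_slash, ← sub_eq_add_neg]

lemma κ_mul {g h : GL (Fin 2) ℝ} (hg : 0 < g.det.val) (hh : 0 < h.det.val) :
    κ (g * h) = κ g ∣[(2 : ℤ)] h + κ h := by
  have hκ : κ g = L (Disc ∣[(12 : ℤ)] g) - L Disc := rfl
  ext z
  rw [hκ, sub_slash, Pi.add_apply, Pi.sub_apply, κ, κ, SlashAction.slash_mul,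
    L_slash (Disc_mdiff.slash _ _) (Disc_slash_ne_zero hg) hh,
    L_slash Disc_mdiff Disc_ne_zero hh]
  ring

lemma κ_SL (γ : SL(2, ℤ)) : κ (Matrix.SpecialLinearGroup.mapGL ℝ γ) = 0 := by
  ext z
  have : Disc ∣[(12 : ℤ)] (Matrix.SpecialLinearGroup.mapGL ℝ γ) = Disc := Disc_SL γ
  rw [κ, this, sub_self, Pi.zero_apply]

lemma det_SL_pos (γ : SL(2, ℤ)) : 0 < (Matrix.SpecialLinearGroup.mapGL ℝ γ).det.val := by
  simp

lemma L_Disc : L Disc = EisensteinSeries.E2 := by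
  ext z
  have hpi : (Real.pi : ℂ) ≠ 0 := by exact_mod_cast Real.pi_ne_zero
  have h := logDeriv_Disc z
  rw [logDeriv_apply, Function.comp_apply, ofComplex_apply] at h
  rw [L, Derivative.normalizedDerivOfComplex, mul_div_assoc, h]
  have := I_ne_zero
  field_simp

lemma muFun_eq (γ : GQ) : muFun γ = (1 / 6 : ℂ) • κ (toGLR γ) := by
  ext z
  have hpi : (Real.pi : ℂ) ≠ 0 := by exact_mod_cast Real.pi_ne_zero
  have hr : ratio 12 γ ≠ 0 := by
    have := Real.rpow_pos_of_pos (det_pos γ) (1 - ((12 : ℕ) : ℝ) / 2)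
    exact Complex.ofReal_ne_zero.mpr this.ne'
  have h1 : ((fun w => slash 12 Disc γ w / Disc w) ∘ ofComplex) =
      fun w => ratio 12 γ * (((Disc ∣[(12 : ℤ)] toGLR γ) ∘ ofComplex) w / (Disc ∘ ofComplex) w) := by
    ext w
    simp [slash_eq, mul_div_assoc]
  have hd1 := UpperHalfPlane.mdifferentiableAt_iff.mp (Disc_mdiff.slash 12 (toGLR γ) z)
  have hd2 := UpperHalfPlane.mdifferentiableAt_iff.mp (Disc_mdiff z)
  have hn1 : ((Disc ∣[(12 : ℤ)] toGLR γ) ∘ ofComplex) z ≠ 0 := by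
    simpa using Disc_slash_ne_zero (det_pos γ) z
  have hn2 : (Disc ∘ ofComplex) z ≠ 0 := by simpa using Disc_ne_zero z
  rw [muFun, h1, logDeriv_const_mul _ _ hr, logDeriv_div _ hn1 hn2 hd1 hd2]
  simp only [logDeriv_apply, Pi.smul_apply, smul_eq_mul, κ, L, Derivative.normalizedDerivOfComplex,
    Function.comp_apply, ofComplex_apply]
  have := I_ne_zero
  field_simp
  ring

/-- Every element of `GL(2, ℚ)` is a product of an element of `SL(2, ℤ)` and an upper triangular
matrix. -/
lemma exists_upper (g : GL (Fin 2) ℚ) : ∃ γ : SL(2, ℤ), ∃ β : GL (Fin 2) ℚ,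
    g = Matrix.SpecialLinearGroup.mapGL ℚ γ * β ∧ β 1 0 = 0 := by
  obtain ⟨γ, hγ⟩ := OnePoint.exists_mem_SL2 ℤ (g • (OnePoint.infty : OnePoint ℚ))
  refine ⟨γ, (Matrix.SpecialLinearGroup.mapGL ℚ γ)⁻¹ * g, by simp, ?_⟩
  rw [← OnePoint.smul_infty_eq_self_iff, mul_smul, ← hγ, inv_smul_smul]

lemma map_mapGL (γ : SL(2, ℤ)) : Matrix.GeneralLinearGroup.map (Rat.castHom ℝ)
    (Matrix.SpecialLinearGroup.mapGL ℚ γ) = Matrix.SpecialLinearGroup.mapGL ℝ γ := by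
  ext i j
  simp

lemma κ_bounded (g : GL (Fin 2) ℚ)
    (hg : 0 < (Matrix.GeneralLinearGroup.map (Rat.castHom ℝ) g).det.val) :
    IsBoundedAtImInfty (κ (Matrix.GeneralLinearGroup.map (Rat.castHom ℝ) g)) := by
  obtain ⟨γ, β, rfl, hβ⟩ := exists_upper g
  rw [map_mul, map_mapGL] at hg ⊢
  set b := Matrix.GeneralLinearGroup.map (Rat.castHom ℝ) β with hb
  have hb0 : b 1 0 = 0 := by simp [hb, hβ]
  have hbd : 0 < b.det.val := by simpa using hg
  rw [κ_mul (det_SL_pos γ) hbd, κ_SL, SlashAction.zero_slash, zero_add]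
  have : κ b = L Disc ∣[(2 : ℤ)] b - L Disc := by
    ext z
    rw [κ, L_slash Disc_mdiff Disc_ne_zero hbd, hb0]
    simp
  rw [this, L_Disc]
  exact (EisensteinSeries.isBoundedAtImInfty_E2.slash 2 hb0).sub
    EisensteinSeries.isBoundedAtImInfty_E2

lemma L_mdiff {F : ℍ → ℂ} (hF : MDiff F) (h0 : ∀ z, F z ≠ 0) : MDiff (L F) := by
  rw [UpperHalfPlane.mdifferentiable_iff]
  have h1 := UpperHalfPlane.mdifferentiable_iff.mp hF
  have h2 := UpperHalfPlane.mdifferentiable_iff.mp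
    (Derivative.normalizedDerivOfComplex_mdifferentiable hF)
  exact h2.div h1 fun z _ => h0 _

/-- `μ_γ` is a modular form of weight `2`. -/
lemma muFun_mem (γ : GQ) : muFun γ ∈ M 2 := by
  rw [muFun_eq]
  refine (M 2).smul_mem _ ?_
  obtain ⟨N, hN, h⟩ := CongruenceSubgroup.exists_Gamma_le_conj γ.1 1
  have hpos : 0 < (toGLR γ).det.val := det_pos γ
  have hslash : ∀ α : SL(2, ℤ), κ (toGLR γ) ∣[(2 : ℤ)] α =
      κ (toGLR γ * Matrix.SpecialLinearGroup.mapGL ℝ α) := fun α => by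
    rw [κ_mul hpos (det_SL_pos α), κ_SL, add_zero]
    rfl
  refine mem_M_of N hN ?_ ?_ ?_
  · exact (L_mdiff (Disc_mdiff.slash _ _) (Disc_slash_ne_zero hpos)).sub
      (L_mdiff Disc_mdiff Disc_ne_zero)
  · intro α hα
    obtain ⟨α', -, h'⟩ := h α hα
    have h3 : toGLR γ * Matrix.SpecialLinearGroup.mapGL ℝ α =
        Matrix.SpecialLinearGroup.mapGL ℝ α' * toGLR γ := by
      have h4 := congr_arg (Matrix.GeneralLinearGroup.map (Rat.castHom ℝ)) (eq_mul_inv_iff_mul_eq.mp h')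
      rw [map_mul, map_mul, map_mapGL, map_mapGL] at h4
      exact h4.symm
    refine (hslash α).trans ?_
    rw [h3, κ_mul (det_SL_pos α') hpos, κ_SL, SlashAction.zero_slash, zero_add]
  · intro α
    have h5 : toGLR γ * Matrix.SpecialLinearGroup.mapGL ℝ α =
        Matrix.GeneralLinearGroup.map (Rat.castHom ℝ)
          (γ.1 * Matrix.SpecialLinearGroup.mapGL ℚ α) := by
      rw [map_mul, map_mapGL]; rfl
    have h6 : IsBoundedAtImInfty (κ (toGLR γ * Matrix.SpecialLinearGroup.mapGL ℝ α)) := by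
      rw [h5]
      apply κ_bounded
      rw [← h5]
      simpa using hpos
    rw [← hslash] at h6
    exact h6

/-- The operator `X : ℳₖ → ℳₖ₊₂`. -/
def XL (k : ℕ) : M k →ₗ[ℂ] M (k + 2) where
  toFun f := ⟨XFun k f, XFun_mem f.2⟩
  map_add' f g := Subtype.ext (by
    simp only [XFun_eq, Submodule.coe_add]
    exact Derivative.serreDerivative_add _ _ _ (M_mdiff f.2) (M_mdiff g.2))
  map_smul' c f := Subtype.ext (by
    simp only [XFun_eq, Submodule.coe_smul, RingHom.id_apply]
    exact Derivative.serreDerivative_smul _ _ _ (M_mdiff f.2))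

/-- The operator `X` on `ℳ`. -/
def XMod : Mod →ₗ[ℂ] Mod := ModLift fun k => ofM (k + 2) ∘ₗ XL k

/-- The grading operator `Y` on `ℳ`: `Y f = (k/2) f` for `f` of weight `k`. -/
def YMod : Mod →ₗ[ℂ] Mod := ModLift fun k => ((k : ℂ) / 2) • ofM k

/-- `μ_γ` as an element of `ℳ`, homogeneous of weight `2`. -/
def mu (γ : GQ) : Mod := ofM 2 ⟨muFun γ, muFun_mem γ⟩

/-! ### Hopf actions -/

open scoped TensorProduct

/-- An action `ρ` of a bialgebra `H` on a unital algebra `A` is a Hopf action if `A` is an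
`H`-module algebra: `h(ab) = ∑ h₍₁₎(a) h₍₂₎(b)` and `h(1) = ε(h) 1`. -/
structure IsHopfAction {H A : Type*} [Ring H] [Bialgebra ℂ H] [Ring A] [Algebra ℂ A]
    (ρ : H →ₐ[ℂ] Module.End ℂ A) : Prop where
  map_mul : ∀ (h : H) (a b : A), ρ h (a * b) =
    LinearMap.mul' ℂ A (TensorProduct.map (ρ.toLinearMap.flip a) (ρ.toLinearMap.flip b)
      (Coalgebra.comul (R := ℂ) h))
  map_one : ∀ h : H, ρ h 1 = Coalgebra.counit (R := ℂ) h • (1 : A)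

/-- The prescribed action of the generators `X`, `Y`, `δ₁` of `H₁` on the crossed product. -/
structure IsPrescribed (ρ : H1 →ₐ[ℂ] Module.End ℂ CrossedProduct) : Prop where
  X : ∀ (f : Mod) (γ : GQ), ρ H1.X (fU f γ) = fU (XMod f) γ
  Y : ∀ (f : Mod) (γ : GQ), ρ H1.Y (fU f γ) = fU (YMod f) γ
  δ : ∀ (f : Mod) (γ : GQ), ρ (H1.δ 1) (fU f γ) = fU (mu γ * f) γ

end

end ConnesMoscovici

namespace ConnesMoscovici

open UpperHalfPlane hiding I
open Complex
open scoped MatrixGroups ModularForm Manifold TensorProduct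

noncomputable section

/-! ### The operators on `ℳ` -/

/-! Since `X`, `Y` and `δ₁` generate `H₁` as an algebra and the elements `f U*_γ` span the crossed
product, there is at most one action with the prescribed values. Existence requires the relations of
`H₁` and its coproduct to be respected.

The relations come from the grading and from commutativity of `ℳ`. `X` raises the weight by 2, so
`[Y, X] = X`; `μ_γ` has weight 2, so `[Y, δ₁] = δ₁`. Every `δₙ` acts by multiplying the fibre over
`γ` by an element of `ℳ`: bracketing such an operator with the derivation `X` only replaces the
multipliers by their images under `X`. Such operators commute, and the formula for `δₙ` appears by
iteration.

The coproduct formulas reflect the product `f U*_α · g U*_β = (f · g|α) U*_{βα}`. The operators `X`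
and `Y` are derivations of `ℳ`, and `Y` commutes with the slash action, but `X(g|α) = X(g)|α + μ_α ·
Y(g)|α` (`XMod_slashMod`). The defect is exactly the term `δ₁ ⊗ Y` of the coproduct of `X`. The
cocycle identity `μ_{βα} = μ_β|α + μ_α` (`mu_mul`) makes `δ₁` a derivation. Compatibility for all of
`H₁` follows from these three cases because the coproduct and the counit are algebra maps
(`isHopfAction_of_generators`). -/

lemma ofM_congr {k l : ℕ} (h : k = l) {f : M k} {g : M l} (hfg : (f : ℍ → ℂ) = g) :
    ofM k f = ofM l g := by
  subst h
  exact congr_arg _ (Subtype.ext hfg)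

@[simp] lemma XMod_ofM (k : ℕ) (f : M k) : XMod (ofM k f) = ofM (k + 2) (XL k f) :=
  ModLift_ofM _ k f

@[simp] lemma YMod_ofM (k : ℕ) (f : M k) : YMod (ofM k f) = ((k : ℂ) / 2) • ofM k f :=
  ModLift_ofM _ k f

/-- `Y` is a derivation of `ℳ`. -/
lemma YMod_mul (f g : Mod) : YMod (f * g) = YMod f * g + f * YMod g := by
  have h : (LinearMap.mul ℂ Mod).compr₂ YMod =
      (LinearMap.mul ℂ Mod).compl₁₂ YMod LinearMap.id +
        (LinearMap.mul ℂ Mod).compl₁₂ LinearMap.id YMod := by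
    refine Mod_ext fun k f => Mod_ext fun l g => ?_
    simp only [LinearMap.compr₂_apply, LinearMap.compl₁₂_apply, LinearMap.mul_apply',
      LinearMap.add_apply, LinearMap.id_apply, YMod_ofM, smul_mul_assoc, mul_smul_comm, ofM_mul]
    rw [← add_smul]
    congr 1
    push_cast
    ring
  exact congr($h f g)

/-- `X` is a derivation of `ℳ`. -/
lemma XMod_mul (f g : Mod) : XMod (f * g) = XMod f * g + f * XMod g := by
  have h : (LinearMap.mul ℂ Mod).compr₂ XMod =
      (LinearMap.mul ℂ Mod).compl₁₂ XMod LinearMap.id +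
        (LinearMap.mul ℂ Mod).compl₁₂ LinearMap.id XMod := by
    refine Mod_ext fun k f => Mod_ext fun l g => ?_
    simp only [LinearMap.compr₂_apply, LinearMap.compl₁₂_apply, LinearMap.mul_apply',
      LinearMap.add_apply, LinearMap.id_apply, XMod_ofM, ofM_mul]
    -- The terms live in the weights `k + 2 + l`, `k + (l + 2)` and `k + l + 2`, which are equal but
    -- index different types. Both products are moved to the last weight so that they can be added
    -- in one homogeneous component.
    have hmem : (XFun k f * g : ℍ → ℂ) ∈ M (k + l + 2) := by
      rw [add_right_comm k l 2]
      exact SetLike.mul_mem_graded (XFun_mem f.2) g.2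
    have hmem' : (f * XFun l g : ℍ → ℂ) ∈ M (k + l + 2) := by
      rw [add_assoc]
      exact SetLike.mul_mem_graded f.2 (XFun_mem g.2)
    rw [ofM_congr (k := k + 2 + l) (l := k + l + 2) (by ring) (g := ⟨XFun k f * g, hmem⟩) rfl,
      ofM_congr (k := k + (l + 2)) (l := k + l + 2) (by ring)
        (f := ⟨f * XL l g, SetLike.mul_mem_graded f.2 (XL l g).2⟩) (g := ⟨f * XFun l g, hmem'⟩) rfl, ← map_add]
    refine congr_arg _ (Subtype.ext ?_)
    change XFun (k + l) (f * g) = XFun k f * g + f * XFun l g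
    -- `X` is the Serre derivative. Its correction term is linear in the weight and weights add
    -- under multiplication, hence the Leibniz rule.
    rw [XFun_eq, XFun_eq, XFun_eq, Nat.cast_add]
    exact Derivative.serreDerivative_mul _ _ _ _ (M_mdiff f.2) (M_mdiff g.2)
  exact congr($h f g)

lemma XMod_one : XMod 1 = 0 := by
  simpa using XMod_mul 1 1

lemma YMod_one : YMod 1 = 0 := by
  simpa using YMod_mul 1 1

/-- On weight `k` the operator `Y` is `k/2`, and `X` raises `k` by 2, so the eigenvalue grows by 1.
This is the relation `[Y, X] = X`. -/
lemma YMod_XMod (f : Mod) : YMod (XMod f) = XMod (YMod f) + XMod f := by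
  have h : YMod ∘ₗ XMod = XMod ∘ₗ YMod + XMod := by
    refine Mod_ext fun k f => ?_
    simp only [LinearMap.comp_apply, LinearMap.add_apply, XMod_ofM, YMod_ofM, map_smul]
    push_cast
    module
  exact congr($h f)

lemma YMod_slashMod (γ : GQ) (f : Mod) : YMod (slashMod γ f) = slashMod γ (YMod f) := by
  have h : YMod ∘ₗ slashMod γ = slashMod γ ∘ₗ YMod := by
    refine Mod_ext fun k f => ?_
    simp
  exact congr($h f)

/-- Weight 2 means eigenvalue 1; this gives `[Y, δ₁] = δ₁`. -/
lemma YMod_mu (γ : GQ) : YMod (mu γ) = mu γ := by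
  rw [mu, YMod_ofM]
  norm_num

/-! ### The cocycle `μ` -/

lemma muFun_mul (β α : GQ) : muFun (β * α) = slash 2 (muFun β) α + muFun α := by
  -- The exponent `1 - k/2` vanishes at `k = 2`: the two normalizations of the slash agree in this
  -- weight, and `κ_mul` carries over unchanged.
  have hr : ratio 2 α = 1 := by simp [ratio]
  simp only [muFun_eq, map_mul, κ_mul (det_pos β) (det_pos α), slash_eq, hr, one_smul,
    smul_add, ModularForm.smul_slash, σ_toGLR]
  rfl

/-- The cocycle identity `μ_{βα} = μ_β|α + μ_α`. -/
lemma mu_mul (β α : GQ) : mu (β * α) = slashMod α (mu β) + mu α := by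
  rw [mu, mu, mu, slashMod_ofM, ← map_add]
  exact congr_arg _ (Subtype.ext (muFun_mul β α))

/-- The cocycle identity at the neutral element reads `μ₁ = μ₁ + μ₁`. It is needed for `δ₁(1) = 0`.
-/
lemma mu_one : mu 1 = 0 := by
  have h1 : slashMod 1 (mu 1) = mu 1 := one_smul GQᵐᵒᵖ (mu 1)
  have h := mu_mul 1 1
  rw [mul_one, h1] at h
  simpa using h

/-- The factor `det⁻¹` is the one that differentiating the slash with factor `det^{k-1}` produces,
so no determinant survives in `XFun_slash`. -/
lemma ratio_add_two (k : ℕ) (γ : GQ) :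
    ratio (k + 2) γ = ratio k γ * ((toGLR γ).det.val : ℂ)⁻¹ := by
  rw [ratio, ratio, ← Complex.ofReal_inv, ← Complex.ofReal_mul, ← Real.rpow_neg_one,
    ← Real.rpow_add (det_pos γ)]
  congr 2
  push_cast
  ring

/-- The failure of `X` to commute with the slash operation is measured by `μ`. -/
lemma XFun_slash {k : ℕ} {f : ℍ → ℂ} (hf : MDiff f) (γ : GQ) :
    XFun k (slash k f γ) =
      slash (k + 2) (XFun k f) γ + muFun γ * (((k : ℂ) / 2) • slash k f γ) := by
  have hg := det_pos γ
  have hd : ((toGLR γ).det.val : ℂ) ≠ 0 := by exact_mod_cast hg.ne'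
  -- Put `a = (2πi)⁻¹ c/(cz+d)`. Slashing shifts the normalized derivative of `f` by `-k a f|γ` and
  -- the logarithmic derivative of `Δ` by `-12 a`. In this combination the shifts cancel and leave
  -- `(k/12) κ f|γ`, which is `μ_γ · (k/2) f|γ` as `μ_γ = κ/6`.
  have hX : XFun k f = Derivative.normalizedDerivOfComplex f -
      ((k : ℂ) * 12⁻¹) • (L Disc * f) := by
    rw [XFun_eq, L_Disc]
    ext z
    simp [mul_assoc]
  rw [XFun_eq, slash_eq, Derivative.serreDerivative_smul _ _ _ (hf.slash _ _), slash_eq, hX,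
    ratio_add_two, muFun_eq]
  ext z
  have hD := congrFun (Derivative.normalizedDerivOfComplex_slash (k := (k : ℤ)) hf
    (g := toGLR γ) hg) z
  have hL := L_slash Disc_mdiff Disc_ne_zero hg z
  have hdet : (((toGLR γ).val.det : ℝ) : ℂ) = ((toGLR γ).det.val : ℂ) := rfl
  -- With the normalization `det^{k-1}` the slash of a product carries an extra factor `det`.
  have hmul : ((L Disc * f) ∣[((k + 2 : ℕ) : ℤ)] toGLR γ) z =
      ((toGLR γ).det.val : ℂ) *
        ((L Disc ∣[(2 : ℤ)] toGLR γ) z * (f ∣[(k : ℤ)] toGLR γ) z) := by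
    have : (((k + 2 : ℕ) : ℤ)) = 2 + (k : ℤ) := by push_cast; ring
    rw [this, ModularForm.mul_slash, abs_of_pos hg]
    simp
  rw [hdet] at hD
  simp only [sub_slash, ModularForm.smul_slash, σ_toGLR, Pi.add_apply, Pi.sub_apply,
    Pi.smul_apply, Pi.mul_apply, smul_eq_mul, hmul, Derivative.serreDerivative_apply, hD, κ, hL,
    ← L_Disc]
  push_cast
  field_simp
  ring

/-- `X(f|γ) = X(f)|γ + μ_γ Y(f)|γ`. -/
lemma XMod_slashMod (γ : GQ) (f : Mod) :
    XMod (slashMod γ f) = slashMod γ (XMod f) + mu γ * slashMod γ (YMod f) := by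
  have h : XMod ∘ₗ slashMod γ = slashMod γ ∘ₗ XMod +
      LinearMap.mulLeft ℂ (mu γ) ∘ₗ slashMod γ ∘ₗ YMod := by
    refine Mod_ext fun k f => ?_
    simp only [LinearMap.comp_apply, LinearMap.add_apply, LinearMap.mulLeft_apply, slashMod_ofM,
      XMod_ofM, YMod_ofM, ← map_smul, mu, ofM_mul]
    -- The product with `μ_γ` has weight `2 + k`, and the other terms have weight `k + 2`.
    have hmem : (muFun γ * (((k : ℂ) / 2) • slash k f γ) : ℍ → ℂ) ∈ M (k + 2) := by
      rw [add_comm]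
      exact SetLike.mul_mem_graded (muFun_mem γ) ((M k).smul_mem _ (slash_mem f.2 γ))
    rw [ofM_congr (k := 2 + k) (l := k + 2) (by ring) (g := ⟨_, hmem⟩)
      (congr_arg (muFun γ * ·) (slash_smul k _ f γ)), ← map_add]
    exact congr_arg _ (Subtype.ext (XFun_slash (M_mdiff f.2) γ))
  exact congr($h f)

/-! ### Fibrewise operators on the crossed product -/

/-- The linear map `f ↦ f U*_γ`. -/
def fUL (γ : GQ) : Mod →ₗ[ℂ] CrossedProduct := SkewMonoidAlgebra.lsingle ℂ (MulOpposite.op γ)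

lemma fU_add (f g : Mod) (γ : GQ) : fU (f + g) γ = fU f γ + fU g γ := map_add (fUL γ) f g

lemma fU_sub (f g : Mod) (γ : GQ) : fU (f - g) γ = fU f γ - fU g γ := map_sub (fUL γ) f g

lemma fU_zero (γ : GQ) : fU 0 γ = 0 := map_zero (fUL γ)

lemma one_eq_fU : (1 : CrossedProduct) = fU 1 1 := rfl

lemma crossedProduct_ext {V : Type*} [AddCommMonoid V] [Module ℂ V]
    {φ ψ : CrossedProduct →ₗ[ℂ] V} (h : ∀ f γ, φ (fU f γ) = ψ (fU f γ)) : φ = ψ :=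
  SkewMonoidAlgebra.lhom_ext fun γ f => h f γ.unop

/-- The operator `f U*_γ ↦ T_γ(f) U*_γ` on the crossed product. -/
def fibre (T : GQ → Mod →ₗ[ℂ] Mod) : Module.End ℂ CrossedProduct :=
  Finsupp.lsum ℂ (fun γ : GQᵐᵒᵖ => fUL γ.unop ∘ₗ T γ.unop) ∘ₗ
    (SkewMonoidAlgebra.coeffLinearEquiv (S := ℂ) (k := Mod) (G := GQᵐᵒᵖ)).toLinearMap

@[simp] lemma fibre_fU (T : GQ → Mod →ₗ[ℂ] Mod) (f : Mod) (γ : GQ) :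
    fibre T (fU f γ) = fU (T γ f) γ := by
  have h : SkewMonoidAlgebra.coeffLinearEquiv (S := ℂ) (fU f γ) =
      Finsupp.single (MulOpposite.op γ) f := rfl
  rw [fibre, LinearMap.comp_apply, LinearEquiv.coe_coe, h, Finsupp.lsum_single]
  rfl

/-- The multiplication operator `f U*_γ ↦ m_γ f U*_γ` on the crossed product. -/
def fibreMul (m : GQ → Mod) : Module.End ℂ CrossedProduct :=
  fibre fun γ => LinearMap.mulLeft ℂ (m γ)

@[simp] lemma fibreMul_fU (m : GQ → Mod) (f : Mod) (γ : GQ) :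
    fibreMul m (fU f γ) = fU (m γ * f) γ := fibre_fU _ f γ

/-- Commutativity of `ℳ` is the source of `[δₖ, δₙ] = 0`. -/
lemma fibreMul_comm (m m' : GQ → Mod) :
    fibreMul m * fibreMul m' = fibreMul m' * fibreMul m :=
  crossedProduct_ext fun f γ => by simp [mul_left_comm]

/-- The commutator of a fibrewise derivation with a multiplication operator is a multiplication
operator. -/
lemma fibre_fibreMul {d : Mod →ₗ[ℂ] Mod} (hd : ∀ f g, d (f * g) = d f * g + f * d g)
    (m : GQ → Mod) :
    fibre (fun _ => d) * fibreMul m - fibreMul m * fibre (fun _ => d) =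
      fibreMul fun γ => d (m γ) :=
  crossedProduct_ext fun f γ => by simp [hd, fU_add]

/-! ### The action of `H₁` -/

/-- The action of `H₁` on the crossed product. -/
def action : H1 →ₐ[ℂ] Module.End ℂ CrossedProduct :=
  -- The multiplication operators form a commuting set that contains the image of `δ₁` and is stable
  -- under the bracket with `X`, so all the iterated commutators `δₙ` stay inside it.
  H1.lift₁ (fibre fun _ => XMod) (fibre fun _ => YMod) (fibreMul mu) (Set.range fibreMul)
    (crossedProduct_ext fun f γ => by simp [YMod_XMod, fU_add])
    ((fibre_fibreMul YMod_mul mu).trans (by simp only [YMod_mu]))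
    ⟨mu, rfl⟩
    (by
      rintro _ ⟨m, rfl⟩
      exact ⟨_, (fibre_fibreMul XMod_mul m).symm⟩)
    (by
      rintro _ ⟨m, rfl⟩ _ ⟨m', rfl⟩
      exact fibreMul_comm m m')

@[simp] lemma action_X : action H1.X = fibre fun _ => XMod := H1.lift₁_X ..
@[simp] lemma action_Y : action H1.Y = fibre fun _ => YMod := H1.lift₁_Y ..
@[simp] lemma action_δ_one : action (H1.δ 1) = fibreMul mu := H1.lift₁_δ_one ..

lemma isPrescribed_action : IsPrescribed action where
  X f γ := by simp
  Y f γ := by simp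
  δ f γ := by simp

/-! ### Hopf actions of `H₁` and the generators -/

section HopfAction

variable {A : Type*} [Ring A] [Algebra ℂ A] (ρ : H1 →ₐ[ℂ] Module.End ℂ A)

/-- The map `h ⊗ h' ↦ h(a) h'(b)`. -/
def tensorEval (a b : A) : H1 ⊗[ℂ] H1 →ₗ[ℂ] A :=
  LinearMap.mul' ℂ A ∘ₗ TensorProduct.map (ρ.toLinearMap.flip a) (ρ.toLinearMap.flip b)

@[simp] lemma tensorEval_tmul (a b : A) (h h' : H1) :
    tensorEval ρ a b (h ⊗ₜ h') = ρ h a * ρ h' b := by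
  simp [tensorEval]

/-- As `ρ` is multiplicative, right multiplication by `p ⊗ q` amounts to acting on the arguments
first. This drives the product step of the induction below. -/
lemma tensorEval_mul_tmul (a b : A) (t : H1 ⊗[ℂ] H1) (p q : H1) :
    tensorEval ρ a b (t * p ⊗ₜ q) = tensorEval ρ (ρ p a) (ρ q b) t := by
  induction t with
  | zero => simp
  | add s t hs ht => rw [add_mul, map_add, map_add, hs, ht]
  | tmul h h' => simp

/-- It suffices to check the compatibility with products and units on `X`, `Y`, `δ₁`. -/
lemma isHopfAction_of_generators
    (hX : ∀ a b, ρ H1.X (a * b) = ρ H1.X a * b + a * ρ H1.X b + ρ (H1.δ 1) a * ρ H1.Y b)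
    (hY : ∀ a b, ρ H1.Y (a * b) = ρ H1.Y a * b + a * ρ H1.Y b)
    (hd : ∀ a b, ρ (H1.δ 1) (a * b) = ρ (H1.δ 1) a * b + a * ρ (H1.δ 1) b)
    (hX1 : ρ H1.X 1 = 0) (hY1 : ρ H1.Y 1 = 0) (hd1 : ρ (H1.δ 1) 1 = 0) : IsHopfAction ρ where
  map_mul h := by
    -- The claim is kept for all `a`, `b`: the product step uses it for `h` at the pairs `p(a)`,
    -- `q(b)` with `p ⊗ q` from the coproduct of `h'`.
    change ∀ a b, ρ h (a * b) = tensorEval ρ a b (H1.comulHom h)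
    induction h using H1.induction with
    | hX => intro a b; simp [hX]
    | hY => intro a b; simp [hY]
    | hd => intro a b; simp [hd]
    | hc c => intro a b; simp [Algebra.algebraMap_eq_smul_one, Algebra.TensorProduct.one_def]
    | hadd h h' ih ih' => intro a b; simp [ih, ih']
    | hmul h h' ih ih' =>
      intro a b
      have key : ∀ t, ρ h (tensorEval ρ a b t) = tensorEval ρ a b (H1.comulHom h * t) := by
        intro t
        induction t with
        | zero => simp
        | add s t hs ht => rw [mul_add, map_add, map_add, map_add, hs, ht]
        | tmul p q => rw [tensorEval_mul_tmul, tensorEval_tmul, ih]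
      rw [map_mul ρ, map_mul H1.comulHom, Module.End.mul_apply, ih', key]
  map_one h := by
    change ρ h 1 = H1.counitHom h • (1 : A)
    induction h using H1.induction with
    | hX => simp [hX1]
    | hY => simp [hY1]
    | hd => simp [hd1]
    | hc c => simp [Algebra.algebraMap_eq_smul_one]
    | hadd h h' ih ih' => simp [ih, ih', add_smul]
    | hmul h h' ih ih' => rw [map_mul, map_mul, Module.End.mul_apply, ih', map_smul, ih, smul_smul, mul_comm]

end HopfAction

/-! ### The Hopf axioms on the crossed product, and uniqueness -/

lemma crossedProduct_bilin_ext {V : Type*} [AddCommMonoid V] [Module ℂ V]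
    {φ ψ : CrossedProduct →ₗ[ℂ] CrossedProduct →ₗ[ℂ] V}
    (h : ∀ f α g β, φ (fU f α) (fU g β) = ψ (fU f α) (fU g β)) : φ = ψ :=
  crossedProduct_ext fun f α => crossedProduct_ext fun g β => h f α g β

lemma isHopfAction_action : IsHopfAction action := by
  let m := LinearMap.mul ℂ CrossedProduct
  refine isHopfAction_of_generators action (fun a b => ?_) (fun a b => ?_) (fun a b => ?_) ?_ ?_ ?_
  · have h : m.compr₂ (action H1.X) = m.compl₁₂ (action H1.X) LinearMap.id +
        m.compl₁₂ LinearMap.id (action H1.X) + m.compl₁₂ (action (H1.δ 1)) (action H1.Y) :=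
      crossedProduct_bilin_ext fun f α g β => by
        -- The defect `f · μ_α · Y(g)|α` in `X(f · g|α)` is the coefficient of `δ₁(f U*_α) · Y(g
        -- U*_β)`.
        simp only [m, LinearMap.compr₂_apply, LinearMap.compl₁₂_apply, LinearMap.mul_apply',
          LinearMap.add_apply, LinearMap.id_apply, action_X, action_Y, action_δ_one, fibre_fU,
          fibreMul_fU, fU_mul_fU, ← fU_add, XMod_mul, XMod_slashMod]
        congr 1
        ring
    exact congr($h a b)
  · have h : m.compr₂ (action H1.Y) = m.compl₁₂ (action H1.Y) LinearMap.id +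
        m.compl₁₂ LinearMap.id (action H1.Y) :=
      crossedProduct_bilin_ext fun f α g β => by
        simp only [m, LinearMap.compr₂_apply, LinearMap.compl₁₂_apply, LinearMap.mul_apply',
          LinearMap.add_apply, LinearMap.id_apply, action_Y, fibre_fU, fU_mul_fU, ← fU_add,
          YMod_mul, YMod_slashMod]
    exact congr($h a b)
  · have h : m.compr₂ (action (H1.δ 1)) = m.compl₁₂ (action (H1.δ 1)) LinearMap.id +
        m.compl₁₂ LinearMap.id (action (H1.δ 1)) :=
      crossedProduct_bilin_ext fun f α g β => by
        -- The multiplier over `βα` splits by the cocycle identity: `μ_α` acts on `f`, while `μ_β|α`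
        -- combines with `g|α` into `(μ_β g)|α`.
        simp only [m, LinearMap.compr₂_apply, LinearMap.compl₁₂_apply, LinearMap.mul_apply',
          LinearMap.add_apply, LinearMap.id_apply, action_δ_one, fibreMul_fU, fU_mul_fU, ← fU_add,
          mu_mul, slashMod_mul]
        congr 1
        ring
    exact congr($h a b)
  · rw [one_eq_fU, action_X, fibre_fU, XMod_one, fU_zero]
  · rw [one_eq_fU, action_Y, fibre_fU, YMod_one, fU_zero]
  · rw [one_eq_fU, action_δ_one, fibreMul_fU, mu_one, zero_mul, fU_zero]

/-- The action of `δₙ` is forced by the action of `X` and `δ₁`. -/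
lemma IsPrescribed.δ_apply {ρ : H1 →ₐ[ℂ] Module.End ℂ CrossedProduct} (hρ : IsPrescribed ρ)
    (n : ℕ+) (f : Mod) (γ : GQ) :
    ρ (H1.δ n) (fU f γ) = fU (XMod^[(n : ℕ) - 1] (mu γ) * f) γ := by
  -- `f` must vary because the formula for `δₙ` is also applied to `X(f)`.
  induction n using PNat.recOn generalizing f with
  | one => exact hρ.δ f γ
  | succ n ih =>
    have hn : ((n + 1 : ℕ+) : ℕ) - 1 = ((n : ℕ) - 1) + 1 := by
      have := n.pos
      simp only [PNat.add_coe, PNat.one_coe]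
      omega
    -- Expanding `δₙ₊₁ = [X, δₙ]` by the Leibniz rule, the terms `X^{n-1}(μ_γ) · X(f)` cancel and
    -- `X^n(μ_γ) · f` remains.
    rw [← H1.comm_X_δ, map_sub, map_mul, map_mul, LinearMap.sub_apply, Module.End.mul_apply,
      Module.End.mul_apply, ih, hρ.X, hρ.X, ih, hn, Function.iterate_succ_apply', XMod_mul, ← fU_sub,
      add_sub_cancel_right]

lemma IsPrescribed.unique {ρ ρ' : H1 →ₐ[ℂ] Module.End ℂ CrossedProduct} (h : IsPrescribed ρ)
    (h' : IsPrescribed ρ') : ρ = ρ' :=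
  H1.algHom_ext (crossedProduct_ext fun f γ => by rw [h.X, h'.X])
    (crossedProduct_ext fun f γ => by rw [h.Y, h'.Y])
    (crossedProduct_ext fun f γ => by rw [h.δ, h'.δ])

end

end ConnesMoscovici

open ConnesMoscovici in
theorem mainTheorem6 :
    (∃! ρ : H1 →ₐ[ℂ] Module.End ℂ CrossedProduct, IsHopfAction ρ ∧ IsPrescribed ρ) ∧
    ∀ ρ : H1 →ₐ[ℂ] Module.End ℂ CrossedProduct, IsHopfAction ρ → IsPrescribed ρ →
      ∀ (n : ℕ+) (f : Mod) (γ : GQ),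
        ρ (H1.δ n) (fU f γ) = fU (XMod^[(n : ℕ) - 1] (mu γ) * f) γ := by
  refine ⟨⟨action, ⟨isHopfAction_action, isPrescribed_action⟩, fun ρ hρ => ?_⟩, fun ρ _ hρ => ?_⟩
  · exact hρ.2.unique isPrescribed_action
  · exact hρ.δ_apply
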